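/- Consider sequential prediction under the logarithmic loss $\ell(\hat y,y)=-y\log\hat y-(1-y)\log(1-\hat y)\in[0,\infty]$, $\hat y\in[0,1]$, $y\in\{0,1\}$ (with $-\log 0=+\infty$, $0\cdot\infty=0$). For a class $\mathcal H$ of functions $\mathcal X\to[0,1]$ and $T\ge 1$, define the sequential minimax regret $$r^a_T(\mathcal H)=\sup_{x_1\in\mathcal X}\inf_{\hat y_1\in[0,1]}\sup_{y_1\in\{0,1\}}\cdots\sup_{x_T\in\mathcal X}\inf_{\hat y_T\in[0,1]}\sup_{y_T\in\{0,1\}}\Big[\sum_{t=1}^T\ell(\hat y_t,y_t)-\inf_{h\in\mathcal H}\sum_{t=1}^T\ell(h(x_t),y_t)\Big],$$ where the bracket is read as $-\infty$ when $\inf_{h}\sum_t\ell(h(x_t),y_t)=+\infty$. For $d\ge 0$ let $B_d=\{v\in\mathbb R^d:\|v\|_2\le 1\}$ and $\mathcal H_d=\{x\mapsto|\langle w,x\rangle| : w\in B_d\}$, a class of functions on $\mathcal X=B_d$. Then, with constants independent of both $d$ and $T$: 1. (Lower bound $\Omega(T^{2/3})$.) There is an absolute constant $c>0$ such that $r^a_T(\mathcal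 H_d)\ge c\,T^{2/3}$ for all integers $T\ge 1$ and $d\ge T$. 2. (Upper bound $\tilde O(T^{2/3})$.) There are absolute constants $C>0$ and $k\in\mathbb N$ such that $r^a_T(\mathcal H_d)\le C\,T^{2/3}(1+\log T)^k$ for all integers $T\ge 1$ and all $d$; in particular for all $d\ge T$. -/

import Mathlib

noncomputable section

namespace OnlineLogLoss

/-- The logarithmic loss `-y log p - (1 - y) log (1 - p)` of the prediction `p ∈ [0,1]` on the
label `y ∈ {0,1}` (`true` is `1`), with natural logarithm, `-log 0 = +∞` and `0 · ∞ = 0`. -/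
def logLoss (p : unitInterval) (y : Bool) : EReal :=
  if y then -ENNReal.log (ENNReal.ofReal (p : ℝ))
  else -ENNReal.log (ENNReal.ofReal (1 - (p : ℝ)))

/-- The pointwise regret of the predictions `p` on the data `(x, y)` against the class `H`:
the loss of the learner minus the infimum of the losses of the experts in `H`.
In `EReal` one has `⊤ - ⊤ = ⊥`, so the regret is `⊥` whenever every expert has infinite loss. -/
def pointwiseRegret {X : Type*} (H : Set (X → unitInterval)) {T : ℕ}
    (x : Fin T → X) (p : Fin T → unitInterval) (y : Fin T → Bool) : EReal :=
  (∑ t, logLoss (p t) (y t)) - ⨅ h ∈ H, ∑ t, logLoss (h (x t)) (y t)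

/-- The iterated value
`sup_{x₁} inf_{p₁} sup_{y₁} ⋯ sup_{x_T} inf_{p_T} sup_{y_T} R (x, p, y)`. -/
def gameValue {X : Type*} : (T : ℕ) →
    ((Fin T → X) → (Fin T → unitInterval) → (Fin T → Bool) → EReal) → EReal
  | 0, R => R Fin.elim0 Fin.elim0 Fin.elim0
  | T + 1, R => ⨆ x : X, ⨅ p : unitInterval, ⨆ y : Bool,
      gameValue T fun xs ps ys => R (Fin.cons x xs) (Fin.cons p ps) (Fin.cons y ys)

/-- The sequential (agnostic) minimax regret of the class `H` with horizon `T`. -/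
def sequentialRegret {X : Type*} (H : Set (X → unitInterval)) (T : ℕ) : EReal :=
  gameValue T (pointwiseRegret H)

/-- The closed unit `ℓ₂` ball of `ℝ^d`, centered at the origin. -/
abbrev UnitBall (d : ℕ) : Type :=
  Metric.closedBall (0 : EuclideanSpace ℝ (Fin d)) 1

theorem abs_inner_mem_unitInterval {d : ℕ} (w x : UnitBall d) :
    |inner ℝ (w : EuclideanSpace ℝ (Fin d)) (x : EuclideanSpace ℝ (Fin d))| ∈ unitInterval := by
  refine ⟨abs_nonneg _, (abs_real_inner_le_norm _ _).trans ?_⟩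
  exact mul_le_one₀ (mem_closedBall_zero_iff.mp w.2) (norm_nonneg _)
    (mem_closedBall_zero_iff.mp x.2)

/-- The function `f (w, x) = |⟨w, x⟩|` on pairs of points of the unit ball. -/
def absInner {d : ℕ} (w x : UnitBall d) : unitInterval :=
  ⟨|inner ℝ (w : EuclideanSpace ℝ (Fin d)) (x : EuclideanSpace ℝ (Fin d))|,
    abs_inner_mem_unitInterval w x⟩

/-- The class of experts `H_f = {f (w, ·) : w ∈ W}` of a parametrized function `f`. -/
def parametricClass {W X : Type*} (f : W → X → unitInterval) : Set (X → unitInterval) :=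
  Set.range f

end OnlineLogLoss

end

/-!
The regret of the class `x ↦ |⟨w, x⟩|` is of order `T ^ (2 / 3)` up to logarithms, for the following
reasons.

*Upper bound.* Fix a scale `α`. A perceptron that is told when its current vector `v` predicts
`⟨w, x⟩` with an error above `α`, and with which sign, moves by `± α x`; each such move lowers
`‖w - v‖ ^ 2` by at least `α ^ 2`, so at most `α⁻²` moves occur, whatever the dimension. The learner
is not told, so it mixes over all possible histories of moves, where a move in a given direction
has prior probability `ε` in each round. Experts predict with `|⟨v, x⟩|` smoothed to stay above
`α / (1 + 2 α)`. A smoothed prediction within `α` of the truth loses at most `2 α`, and the at most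
`α⁻²` other rounds cost a logarithm each, as does the prior probability of each move. The learner's
loss telescopes in the total weight of the mixture, and `sum_logLoss_mixture_le` carries out the
whole accounting in one induction with the potential `‖w - v‖ ^ 2 / α ^ 2`. The choices
`α = T ^ (-1 / 3)` and `ε = 1 / (T + 2)` give `O (T ^ (2 / 3) * (1 + log T))`.

*Lower bound.* The adversary shows distinct basis vectors `e_1, …, e_T`. On a label sequence with at
most `k` ones the expert `w = k ^ (-1 / 2) • ∑ e_t`, summed over the ones, loses at most
`(k / 2) * log k`, while on any set `S` of label sequences the learner must lose at least `log |S|`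
on some member (`le_gameValue_of_card`): its predictions define a probability on label sequences.
There are at least `(T / (2 k)) ^ k` sequences with exactly `k` ones, and `k ≈ T ^ (2 / 3) / 4` makes
the difference at least `k`.
-/

open Finset
open scoped Nat

namespace OnlineLogLoss

/-! ### The logarithmic loss -/

/-- The probability that the prediction `p` assigns to the label `y`. -/
def labelProb (p : ℝ) (y : Bool) : ℝ := if y then p else 1 - p

theorem logLoss_eq_coe {p : unitInterval} {y : Bool} (h : 0 < labelProb p y) :
    logLoss p y = ((-Real.log (labelProb p y) : ℝ) : EReal) := by
  cases y <;> simp only [labelProb, logLoss, if_true, Bool.false_eq_true, if_false] at h ⊢ <;>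
    rw [ENNReal.log_ofReal, if_neg (not_le.mpr h), EReal.coe_neg]

theorem logLoss_eq_top {p : unitInterval} {y : Bool} (h : labelProb p y ≤ 0) :
    logLoss p y = ⊤ := by
  cases y <;> simp only [labelProb, logLoss, if_true, Bool.false_eq_true, if_false] at h ⊢ <;>
    rw [ENNReal.log_ofReal, if_pos h, EReal.neg_bot]

theorem labelProb_le_one (p : unitInterval) (y : Bool) : labelProb p y ≤ 1 := by
  cases y <;> simp [labelProb, p.2.1, p.2.2]

theorem labelProb_true_add_false (p : ℝ) : labelProb p true + labelProb p false = 1 := by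
  simp [labelProb]

theorem logLoss_nonneg (p : unitInterval) (y : Bool) : 0 ≤ logLoss p y := by
  rcases lt_or_ge 0 (labelProb p y) with h | h
  · rw [logLoss_eq_coe h]
    exact_mod_cast neg_nonneg.mpr (Real.log_nonpos h.le (labelProb_le_one p y))
  · simp [logLoss_eq_top h]

theorem coe_ereal_sum {ι : Type*} (s : Finset ι) (f : ι → ℝ) :
    ((∑ i ∈ s, f i : ℝ) : EReal) = ∑ i ∈ s, (f i : EReal) :=
  map_sum (⟨⟨((↑) : ℝ → EReal), EReal.coe_zero⟩, EReal.coe_add⟩ : ℝ →+ EReal) f s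

/-! ### Strategies of the learner -/

/-- The predictions of a learner with internal state in `S`, who predicts `predict s x` in state `s`
on the input `x`, and then passes to the state `update s x y` on seeing the label `y`. -/
def predictions {S X : Type*} (predict : S → X → unitInterval) (update : S → X → Bool → S) :
    (T : ℕ) → S → (Fin T → X) → (Fin T → Bool) → Fin T → unitInterval
  | 0, _, _, _ => Fin.elim0
  | T + 1, s, x, y => Fin.cons (predict s (x 0))
      (predictions predict update T (update s (x 0) (y 0)) (Fin.tail x) (Fin.tail y))

theorem gameValue_le_of_strategy {S X : Type*} (predict : S → X → unitInterval)
    (update : S → X → Bool → S) (B : EReal) (T : ℕ) (s : S)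
    (R : (Fin T → X) → (Fin T → unitInterval) → (Fin T → Bool) → EReal)
    (h : ∀ x y, R x (predictions predict update T s x y) y ≤ B) : gameValue T R ≤ B := by
  induction T generalizing s with
  | zero => exact h Fin.elim0 Fin.elim0
  | succ T ih =>
    refine iSup_le fun x => iInf_le_of_le (predict s x) <| iSup_le fun y =>
      ih (update s x y) _ fun xs ys => ?_
    simpa [predictions] using h (Fin.cons x xs) (Fin.cons y ys)

/-! ### The Bayesian mixture of perceptrons -/

variable {d : ℕ}

/-- The prediction `|⟨v, x⟩|`, truncated to `[0, 1]` and then smoothed to stay at distance at least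
`α / (1 + 2 α)` from the end points. -/
noncomputable def smoothPrediction (α : ℝ) (v : EuclideanSpace ℝ (Fin d)) (x : UnitBall d) : ℝ :=
  (min 1 |inner ℝ v (x : EuclideanSpace ℝ (Fin d))| + α) / (1 + 2 * α)

theorem div_le_labelProb_smoothPrediction {α : ℝ} (hα : 0 < α) (v : EuclideanSpace ℝ (Fin d))
    (x : UnitBall d) (y : Bool) : α / (1 + 2 * α) ≤ labelProb (smoothPrediction α v x) y := by
  have h0 : 0 ≤ min 1 |inner ℝ v (x : EuclideanSpace ℝ (Fin d))| :=
    le_min zero_le_one (abs_nonneg _)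
  have h1 : min 1 |inner ℝ v (x : EuclideanSpace ℝ (Fin d))| ≤ 1 := min_le_left _ _
  have h2 : 0 < 1 + 2 * α := by positivity
  cases y <;> simp only [labelProb, smoothPrediction, if_true, Bool.false_eq_true, if_false]
  · rw [le_sub_iff_add_le, ← add_div, div_le_one h2]
    linarith
  · gcongr
    linarith

theorem labelProb_smoothPrediction_pos {α : ℝ} (hα : 0 < α) (v : EuclideanSpace ℝ (Fin d))
    (x : UnitBall d) (y : Bool) : 0 < labelProb (smoothPrediction α v x) y :=
  lt_of_lt_of_le (by positivity) (div_le_labelProb_smoothPrediction hα v x y)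

theorem labelProb_absInner_le {α : ℝ} (hα : 0 < α) (w : UnitBall d)
    (v : EuclideanSpace ℝ (Fin d)) (x : UnitBall d) (y : Bool)
    (h : |inner ℝ ((w : EuclideanSpace ℝ (Fin d)) - v) (x : EuclideanSpace ℝ (Fin d))| ≤ α) :
    labelProb (absInner w x) y ≤ (1 + 2 * α) * labelProb (smoothPrediction α v x) y := by
  have h2 : 0 < 1 + 2 * α := by positivity
  have hw := (absInner w x).2
  rw [inner_sub_left] at h
  have h3 := (abs_abs_sub_abs_le _ _).trans h
  rw [abs_le] at h3
  change _ ≤ |inner ℝ (w : EuclideanSpace ℝ (Fin d)) (x : EuclideanSpace ℝ (Fin d))| - _ ∧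
    |inner ℝ (w : EuclideanSpace ℝ (Fin d)) (x : EuclideanSpace ℝ (Fin d))| - _ ≤ _ at h3
  have hm : ((absInner w x : ℝ)) - α ≤ min 1 |inner ℝ v (x : EuclideanSpace ℝ (Fin d))| :=
    le_min (by linarith [hw.2]) (by simp only [absInner]; linarith)
  have hm' : min 1 |inner ℝ v (x : EuclideanSpace ℝ (Fin d))| ≤ (absInner w x : ℝ) + α :=
    (min_le_right _ _).trans (by simp only [absInner]; linarith)
  cases y <;> simp only [labelProb, smoothPrediction, if_true, Bool.false_eq_true, if_false]
  · rw [mul_sub, mul_div_cancel₀ _ h2.ne']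
    linarith
  · rw [mul_div_cancel₀ _ h2.ne']
    linarith

/-- The state of the mixture: a list of weighted perceptron vectors. -/
abbrev MixtureState (d : ℕ) : Type := List (ℝ × EuclideanSpace ℝ (Fin d))

/-- The total weight of a mixture. -/
noncomputable def totalWeight (L : MixtureState d) : ℝ := (L.map Prod.fst).sum

/-- The weight that a mixture assigns to the label `y` on the input `x`. -/
noncomputable def labelWeight (α : ℝ) (L : MixtureState d) (x : UnitBall d) (y : Bool) : ℝ :=
  (L.map fun a => a.1 * labelProb (smoothPrediction α a.2 x) y).sum

/-- The prediction of a mixture: the weighted average of the predictions of its members. The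
projection to `[0, 1]` has no effect when the weights are positive. -/
noncomputable def mixturePredict (α : ℝ) (L : MixtureState d) (x : UnitBall d) : unitInterval :=
  Set.projIcc 0 1 zero_le_one (labelWeight α L x true / totalWeight L)

/-- The Bayesian update of a mixture: each weight is multiplied by the probability of the observed
label and divided among the vectors `v`, `v + α x` and `v - α x`. -/
noncomputable def mixtureUpdate (α ε : ℝ) (L : MixtureState d) (x : UnitBall d) (y : Bool) : MixtureState d :=
  L.flatMap fun a =>
    [(a.1 * labelProb (smoothPrediction α a.2 x) y * (1 - 2 * ε), a.2),
      (a.1 * labelProb (smoothPrediction α a.2 x) y * ε, a.2 + α • (x : EuclideanSpace ℝ (Fin d))),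
      (a.1 * labelProb (smoothPrediction α a.2 x) y * ε, a.2 - α • (x : EuclideanSpace ℝ (Fin d)))]

theorem totalWeight_mixtureUpdate (α ε : ℝ) (L : MixtureState d) (x : UnitBall d) (y : Bool) :
    totalWeight (mixtureUpdate α ε L x y) = labelWeight α L x y := by
  induction L with
  | nil => simp [totalWeight, mixtureUpdate, labelWeight]
  | cons a L ih =>
    simp only [totalWeight, mixtureUpdate, labelWeight, List.flatMap_cons, List.map_append,
      List.sum_append, List.map_cons, List.sum_cons, List.map_nil, List.sum_nil] at ih ⊢
    rw [ih]
    ring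

theorem labelWeight_true_add_false (α : ℝ) (L : MixtureState d) (x : UnitBall d) :
    labelWeight α L x true + labelWeight α L x false = totalWeight L := by
  simp only [labelWeight, totalWeight]
  rw [← List.sum_map_add]
  simp only [← mul_add, labelProb_true_add_false, mul_one]

theorem sum_map_pos {β : Type*} {L : List β} {f : β → ℝ} (hf : ∀ a ∈ L, 0 < f a) (hL : L ≠ []) :
    0 < (L.map f).sum :=
  List.sum_pos _ (by simpa using hf) (by simpa using hL)

theorem labelProb_mixturePredict {α : ℝ} (hα : 0 < α) {L : MixtureState d}
    (hL : ∀ a ∈ L, 0 < a.1) (hne : L ≠ []) (x : UnitBall d) (y : Bool) :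
    labelProb (mixturePredict α L x) y = labelWeight α L x y / totalWeight L := by
  have hpos : ∀ y, 0 < labelWeight α L x y := fun y =>
    sum_map_pos (fun a ha => mul_pos (hL a ha) (labelProb_smoothPrediction_pos hα _ _ _)) hne
  have hW : 0 < totalWeight L := sum_map_pos hL hne
  have hadd := labelWeight_true_add_false α L x
  have hmem : labelWeight α L x true / totalWeight L ∈ Set.Icc (0 : ℝ) 1 :=
    ⟨(div_pos (hpos _) hW).le, by rw [div_le_one hW]; linarith [hpos false]⟩
  rw [mixturePredict, Set.projIcc_of_mem _ hmem]
  cases y <;> simp only [labelProb, if_true, Bool.false_eq_true, if_false]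
  rw [eq_div_iff hW.ne', sub_mul, div_mul_cancel₀ _ hW.ne']
  linarith

theorem fst_pos_of_mem_mixtureUpdate {α ε : ℝ} (hα : 0 < α) (hε : 0 < ε) (hε' : 2 * ε < 1)
    {L : MixtureState d} (hL : ∀ a ∈ L, 0 < a.1) (x : UnitBall d) (y : Bool) :
    ∀ a ∈ mixtureUpdate α ε L x y, 0 < a.1 := by
  intro a ha
  simp only [mixtureUpdate, List.mem_flatMap, List.mem_cons, List.not_mem_nil, or_false] at ha
  obtain ⟨b, hb, rfl | rfl | rfl⟩ := ha <;>
    have := mul_pos (hL b hb) (labelProb_smoothPrediction_pos hα b.2 x y)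
  · exact mul_pos this (by linarith)
  · exact mul_pos this hε
  · exact mul_pos this hε

/-- The perceptron step: moving by `α x` in the direction of an error larger than `α` decreases the
squared distance to the target by at least `α ^ 2`. -/
theorem norm_sub_sq_le_of_lt_inner {α : ℝ} (hα : 0 < α) (u : EuclideanSpace ℝ (Fin d))
    (x : EuclideanSpace ℝ (Fin d)) (hx : ‖x‖ ≤ 1) (h : α ≤ inner ℝ u x) :
    ‖u - α • x‖ ^ 2 ≤ ‖u‖ ^ 2 - α ^ 2 := by
  rw [norm_sub_sq_real, inner_smul_right, norm_smul, Real.norm_of_nonneg hα.le, mul_pow]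
  have h1 : ‖x‖ ^ 2 ≤ 1 := pow_le_one₀ (norm_nonneg _) hx
  nlinarith [mul_le_mul_of_nonneg_left h1 (sq_nonneg α), mul_le_mul_of_nonneg_left h hα.le]

/-- One round of the mixture, from the point of view of a member of weight `ω` and vector `v`: one of
its three descendants either pays `2 α` more than the expert `w` and keeps `v`, or pays a logarithm
and decreases the potential `‖w - v‖ ^ 2 / α ^ 2` by at least `1`. -/
theorem exists_mem_mixtureUpdate {α ε : ℝ} (hα : 0 < α) (hε : 0 < ε) (hε' : 2 * ε < 1)
    {L : MixtureState d} (hL : ∀ a ∈ L, 0 < a.1) {ω : ℝ} {v : EuclideanSpace ℝ (Fin d)}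
    (hmem : (ω, v) ∈ L) (w x : UnitBall d) (y : Bool) (hw : 0 < labelProb (absInner w x) y) :
    ∃ b ∈ mixtureUpdate α ε L x y,
      -Real.log b.1 + ‖(w : EuclideanSpace ℝ (Fin d)) - b.2‖ ^ 2 / α ^ 2 *
          (Real.log ((1 + 2 * α) / α) - Real.log ε) ≤
        -Real.log ω + ‖(w : EuclideanSpace ℝ (Fin d)) - v‖ ^ 2 / α ^ 2 *
          (Real.log ((1 + 2 * α) / α) - Real.log ε) +
          (-Real.log (labelProb (absInner w x) y) + (2 * α - Real.log (1 - 2 * ε))) := by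
  have hω : 0 < ω := hL _ hmem
  set P := labelProb (smoothPrediction α v x) y with hP
  have hP0 : 0 < P := labelProb_smoothPrediction_pos hα v x y
  set K := Real.log ((1 + 2 * α) / α) - Real.log ε with hK
  have hK0 : 0 ≤ K := by
    have h1 : 0 ≤ Real.log ((1 + 2 * α) / α) := by
      apply Real.log_nonneg
      rw [le_div_iff₀ hα]
      linarith
    have h2 : Real.log ε ≤ 0 := Real.log_nonpos hε.le (by linarith)
    linarith
  have hx : ‖(x : EuclideanSpace ℝ (Fin d))‖ ≤ 1 := mem_closedBall_zero_iff.mp x.2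
  have hlogw : 0 ≤ -Real.log (labelProb (absInner w x) y) :=
    neg_nonneg.mpr (Real.log_nonpos hw.le (labelProb_le_one _ _))
  have hloge : 0 ≤ -Real.log (1 - 2 * ε) :=
    neg_nonneg.mpr (Real.log_nonpos (by linarith) (by linarith))
  -- Both kinds of moves are accounted for in the same way.
  have hmove : ∀ v' : EuclideanSpace ℝ (Fin d),
      ‖(w : EuclideanSpace ℝ (Fin d)) - v'‖ ^ 2 ≤
        ‖(w : EuclideanSpace ℝ (Fin d)) - v‖ ^ 2 - α ^ 2 →
      -Real.log (ω * P * ε) + ‖(w : EuclideanSpace ℝ (Fin d)) - v'‖ ^ 2 / α ^ 2 * K ≤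
        -Real.log ω + ‖(w : EuclideanSpace ℝ (Fin d)) - v‖ ^ 2 / α ^ 2 * K +
          (-Real.log (labelProb (absInner w x) y) + (2 * α - Real.log (1 - 2 * ε))) := by
    intro v' hv'
    have h1 : ‖(w : EuclideanSpace ℝ (Fin d)) - v'‖ ^ 2 / α ^ 2 ≤
        ‖(w : EuclideanSpace ℝ (Fin d)) - v‖ ^ 2 / α ^ 2 - 1 := by
      rw [div_sub_one (by positivity)]
      gcongr
    have h2 := mul_le_mul_of_nonneg_right h1 hK0
    have h3 : -Real.log P ≤ Real.log ((1 + 2 * α) / α) := by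
      rw [neg_le, ← Real.log_inv, inv_div]
      exact Real.log_le_log (by positivity) (div_le_labelProb_smoothPrediction hα v x y)
    rw [Real.log_mul (by positivity) hε.ne', Real.log_mul hω.ne' hP0.ne']
    linarith
  by_cases hc : |inner ℝ ((w : EuclideanSpace ℝ (Fin d)) - v) (x : EuclideanSpace ℝ (Fin d))| ≤ α
  · refine ⟨(ω * P * (1 - 2 * ε), v), List.mem_flatMap.mpr ⟨_, hmem, by simp [hP]⟩, ?_⟩
    have h1 := Real.log_le_log hw (labelProb_absInner_le hα w v x y hc)
    rw [Real.log_mul (by positivity) hP0.ne'] at h1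
    have h2 := Real.log_le_sub_one_of_pos (show 0 < 1 + 2 * α by positivity)
    simp only
    rw [Real.log_mul (by positivity) (by linarith), Real.log_mul hω.ne' hP0.ne']
    linarith
  · rcases lt_abs.mp (not_le.mp hc) with h | h
    · refine ⟨(ω * P * ε, v + α • (x : EuclideanSpace ℝ (Fin d))),
        List.mem_flatMap.mpr ⟨_, hmem, by simp [hP]⟩, hmove _ ?_⟩
      rw [← sub_sub]
      exact norm_sub_sq_le_of_lt_inner hα _ _ hx h.le
    · refine ⟨(ω * P * ε, v - α • (x : EuclideanSpace ℝ (Fin d))),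
        List.mem_flatMap.mpr ⟨_, hmem, by simp [hP]⟩, hmove _ ?_⟩
      have := norm_sub_sq_le_of_lt_inner hα ((w : EuclideanSpace ℝ (Fin d)) - v) _
        ((norm_neg (x : EuclideanSpace ℝ (Fin d))).trans_le hx) (by rw [inner_neg_right]; exact h.le)
      rwa [smul_neg, ← sub_add_eq_sub_sub, ← sub_eq_add_neg] at this

/-- The cumulative loss of the mixture, compared with an expert `w` of finite loss, from the point of
view of a member of weight `ω` and vector `v`. -/
theorem sum_logLoss_mixture_le {α ε : ℝ} (hα : 0 < α) (hε : 0 < ε) (hε' : 2 * ε < 1)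
    (w : UnitBall d) (T : ℕ) (L : MixtureState d) (hL : ∀ a ∈ L, 0 < a.1) {ω : ℝ}
    {v : EuclideanSpace ℝ (Fin d)} (hmem : (ω, v) ∈ L) (x : Fin T → UnitBall d)
    (y : Fin T → Bool) (hw : ∀ t, 0 < labelProb (absInner w (x t)) (y t)) :
    ∑ t, logLoss (predictions (mixturePredict α) (mixtureUpdate α ε) T L x y t) (y t) ≤
      ((Real.log (totalWeight L) +
        (-Real.log ω + ‖(w : EuclideanSpace ℝ (Fin d)) - v‖ ^ 2 / α ^ 2 *
          (Real.log ((1 + 2 * α) / α) - Real.log ε)) +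
        (∑ t, -Real.log (labelProb (absInner w (x t)) (y t)) +
          T * (2 * α - Real.log (1 - 2 * ε))) : ℝ) : EReal) := by
  induction T generalizing L ω v with
  | zero =>
    have hω : 0 < ω := hL _ hmem
    have hle : ω ≤ totalWeight L := List.single_le_sum (by
      simp only [List.mem_map]
      rintro _ ⟨a, ha, rfl⟩
      exact (hL a ha).le) _ (List.mem_map.mpr ⟨_, hmem, rfl⟩)
    have h1 := Real.log_le_log hω hle
    have h2 : 0 ≤ Real.log ((1 + 2 * α) / α) := by
      apply Real.log_nonneg
      rw [le_div_iff₀ hα]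
      linarith
    have h3 : Real.log ε ≤ 0 := Real.log_nonpos hε.le (by linarith)
    have h4 : 0 ≤ ‖(w : EuclideanSpace ℝ (Fin d)) - v‖ ^ 2 / α ^ 2 *
        (Real.log ((1 + 2 * α) / α) - Real.log ε) :=
      mul_nonneg (by positivity) (by linarith)
    simp only [univ_eq_empty, sum_empty, Nat.cast_zero, zero_mul]
    exact_mod_cast (by linarith)
  | succ T ih =>
    have hne : L ≠ [] := List.ne_nil_of_mem hmem
    obtain ⟨b, hb, hle⟩ := exists_mem_mixtureUpdate hα hε hε' hL hmem w (x 0) (y 0) (hw 0)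
    have hrec := ih (mixtureUpdate α ε L (x 0) (y 0))
      (fst_pos_of_mem_mixtureUpdate hα hε hε' hL (x 0) (y 0)) (ω := b.1) (v := b.2) hb
      (Fin.tail x) (Fin.tail y) (fun t => hw t.succ)
    have hW : 0 < totalWeight L := sum_map_pos hL hne
    have hl : 0 < labelWeight α L (x 0) (y 0) :=
      sum_map_pos (fun a ha => mul_pos (hL a ha) (labelProb_smoothPrediction_pos hα _ _ _)) hne
    have hp := labelProb_mixturePredict hα hL hne (x 0) (y 0)
    have h0 : 0 < labelProb (mixturePredict α L (x 0)) (y 0) := by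
      rw [hp]
      positivity
    rw [Fin.sum_univ_succ, Fin.sum_univ_succ]
    simp only [predictions, Fin.cons_zero, Fin.cons_succ]
    refine (add_le_add (logLoss_eq_coe h0).le hrec).trans ?_
    rw [← EReal.coe_add, EReal.coe_le_coe_iff, hp, Real.log_div hl.ne' hW.ne',
      totalWeight_mixtureUpdate]
    simp only [Fin.tail] at hle ⊢
    push_cast
    linarith

/-- The regret bound for arbitrary parameters: the mixture starts from the vector `0`, so the
potential is at most `1 / α ^ 2`. -/
theorem sequentialRegret_absInner_le {α ε : ℝ} (hα : 0 < α) (hε : 0 < ε) (hε' : 2 * ε < 1)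
    (d T : ℕ) :
    sequentialRegret (parametricClass (absInner (d := d))) T ≤
      ((1 / α ^ 2 * (Real.log ((1 + 2 * α) / α) - Real.log ε) +
        T * (2 * α - Real.log (1 - 2 * ε)) : ℝ) : EReal) := by
  refine gameValue_le_of_strategy (mixturePredict α) (mixtureUpdate α ε) _ T [(1, 0)] _
    fun x y => ?_
  rw [pointwiseRegret]
  refine EReal.sub_le_of_le_add' ?_
  -- The bound is real, so it can be moved across the infimum, which leaves a single expert `w`.
  rw [← EReal.sub_le_iff_le_add (.inl (EReal.coe_ne_bot _)) (.inl (EReal.coe_ne_top _))]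
  refine le_iInf₂ fun h hh => ?_
  obtain ⟨w, rfl⟩ := hh
  rw [EReal.sub_le_iff_le_add (.inl (EReal.coe_ne_bot _)) (.inl (EReal.coe_ne_top _))]
  by_cases hw : ∀ t, 0 < labelProb (absInner w (x t)) (y t)
  · refine (sum_logLoss_mixture_le hα hε hε' w T [(1, 0)] (by simp) (List.mem_singleton.mpr rfl)
      x y hw).trans ?_
    rw [sum_congr rfl fun t _ => logLoss_eq_coe (hw t)]
    rw [← coe_ereal_sum, ← EReal.coe_add, EReal.coe_le_coe_iff]
    have h1 : ‖(w : EuclideanSpace ℝ (Fin d))‖ ^ 2 ≤ 1 :=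
      pow_le_one₀ (norm_nonneg _) (mem_closedBall_zero_iff.mp w.2)
    have h2 : 0 ≤ Real.log ((1 + 2 * α) / α) := by
      apply Real.log_nonneg
      rw [le_div_iff₀ hα]
      linarith
    have h3 : Real.log ε ≤ 0 := Real.log_nonpos hε.le (by linarith)
    have h4 : ‖(w : EuclideanSpace ℝ (Fin d))‖ ^ 2 / α ^ 2 *
        (Real.log ((1 + 2 * α) / α) - Real.log ε) ≤
          1 / α ^ 2 * (Real.log ((1 + 2 * α) / α) - Real.log ε) := by
      gcongr
      linarith
    simp only [totalWeight, List.map_cons, List.map_nil, List.sum_cons, List.sum_nil, add_zero,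
      Real.log_one, sub_zero, neg_zero, zero_add]
    linarith
  · -- An expert of infinite loss is no competition.
    push Not at hw
    obtain ⟨t, ht⟩ := hw
    have htop : ∑ t, logLoss (absInner w (x t)) (y t) = ⊤ := by
      refine top_le_iff.mp ((logLoss_eq_top ht).symm.le.trans ?_)
      exact single_le_sum (fun i _ => logLoss_nonneg (absInner w (x i)) (y i)) (mem_univ t)
    rw [htop, EReal.top_add_coe]
    exact le_top

theorem exists_sequentialRegret_absInner_le :
    ∃ (C : ℝ) (k : ℕ), 0 < C ∧ ∀ T d : ℕ, 1 ≤ T →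
      sequentialRegret (parametricClass (absInner (d := d))) T ≤
        ((C * (T : ℝ) ^ (2 / 3 : ℝ) * (1 + Real.log T) ^ k : ℝ) : EReal) := by
  refine ⟨9, 1, by norm_num, fun T d hT => ?_⟩
  have hT1 : (1 : ℝ) ≤ T := by exact_mod_cast hT
  have hT0 : (0 : ℝ) < T := by linarith
  set u : ℝ := (T : ℝ) ^ (1 / 3 : ℝ) with hu
  have hu0 : 0 < u := Real.rpow_pos_of_pos hT0 _
  have hu1 : 1 ≤ u := Real.one_le_rpow hT1 (by norm_num)
  have hu3 : u ^ 3 = T := by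
    rw [hu, ← Real.rpow_natCast, ← Real.rpow_mul hT0.le]
    norm_num
  have hu2 : (T : ℝ) ^ (2 / 3 : ℝ) = u ^ 2 := by
    rw [hu, ← Real.rpow_natCast, ← Real.rpow_mul hT0.le]
    norm_num
  have hlogu : Real.log T = 3 * Real.log u := by
    rw [← hu3, Real.log_pow]
    norm_num
  have hlu : 0 ≤ Real.log u := Real.log_nonneg hu1
  have hlog3 : Real.log 3 ≤ 2 := by
    linarith [Real.log_le_sub_one_of_pos (show (0 : ℝ) < 3 by norm_num)]
  refine (sequentialRegret_absInner_le (α := 1 / u) (ε := 1 / (T + 2)) (by positivity)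
    (by positivity) (by rw [mul_one_div, div_lt_one (by positivity)]; linarith) d T).trans ?_
  rw [EReal.coe_le_coe_iff, hu2, pow_one]
  have e1 : Real.log ((1 + 2 * (1 / u)) / (1 / u)) ≤ 2 + Real.log u := by
    have : (1 + 2 * (1 / u)) / (1 / u) = u + 2 := by field_simp
    rw [this]
    calc Real.log (u + 2) ≤ Real.log (3 * u) := Real.log_le_log (by positivity) (by linarith)
      _ = Real.log 3 + Real.log u := Real.log_mul (by norm_num) hu0.ne'
      _ ≤ _ := by linarith
  have e2 : -Real.log (1 / ((T : ℝ) + 2)) ≤ 2 + 3 * Real.log u := by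
    rw [one_div, Real.log_inv, neg_neg, ← hlogu]
    calc Real.log (T + 2) ≤ Real.log (3 * T) := Real.log_le_log (by positivity) (by linarith)
      _ = Real.log 3 + Real.log T := Real.log_mul (by norm_num) hT0.ne'
      _ ≤ _ := by linarith
  have e3 : T * -Real.log (1 - 2 * (1 / ((T : ℝ) + 2))) ≤ 2 := by
    have h1 : 1 - 2 * (1 / ((T : ℝ) + 2)) = (((T : ℝ) + 2) / T)⁻¹ := by field_simp; ring
    have h2 := Real.log_le_sub_one_of_pos (show 0 < ((T : ℝ) + 2) / T by positivity)
    rw [h1, Real.log_inv, neg_neg]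
    calc T * Real.log (((T : ℝ) + 2) / T) ≤ T * (((T : ℝ) + 2) / T - 1) := by gcongr
      _ = 2 := by field_simp; ring
  have e4 : T * (2 * (1 / u)) = 2 * u ^ 2 := by rw [← hu3]; field_simp
  have e5 : 1 / (1 / u) ^ 2 = u ^ 2 := by field_simp
  have e6 : 1 ≤ u ^ 2 := one_le_pow₀ hu1
  have e7 : u ^ 2 * (Real.log ((1 + 2 * (1 / u)) / (1 / u)) - Real.log (1 / ((T : ℝ) + 2))) ≤
      u ^ 2 * (4 + 4 * Real.log u) := by
    gcongr
    linarith
  rw [e5, mul_sub (T : ℝ), e4, hlogu]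
  nlinarith [mul_nonneg (sq_nonneg u) hlu]

/-! ### The adversary -/

/-- The predictions of the learner define a probability on label sequences, so among the members
of `S` some sequence has loss at least `log |S|`. The inputs are fixed in advance. -/
theorem le_gameValue_of_card {X : Type*} (T : ℕ) (x : Fin T → X) (S : Finset (Fin T → Bool))
    (hS : S.Nonempty) (a : EReal)
    (R : (Fin T → X) → (Fin T → unitInterval) → (Fin T → Bool) → EReal)
    (hR : ∀ p, ∀ y ∈ S, a + ∑ t, logLoss (p t) (y t) ≤ R x p y) :
    a + (Real.log S.card : ℝ) ≤ gameValue T R := by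
  induction T generalizing a with
  | zero =>
    have hc : S.card ≤ 1 := card_le_one_of_subsingleton S
    have hc' : S.card = 1 := le_antisymm hc hS.card_pos
    obtain ⟨y, hy⟩ := hS
    have h := hR Fin.elim0 y hy
    rw [Subsingleton.elim x Fin.elim0, Subsingleton.elim y Fin.elim0] at h
    simpa [hc', gameValue] using h
  | succ T ih =>
    refine le_iSup_of_le (x 0) <| le_iInf fun p => ?_
    -- The continuations, within `S`, of the first label `b`.
    let F : Bool → Finset (Fin T → Bool) := fun b => univ.filter fun z => Fin.cons b z ∈ S
    have hcard : (S.card : ℝ) = (F true).card + (F false).card := by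
      have hb : ∀ b, (F b).card = (S.filter fun y => y 0 = b).card := by
        intro b
        refine card_bij (fun z _ => Fin.cons b z) ?_ ?_ ?_
        · intro z hz
          simpa [F] using hz
        · intro z _ z' _ h
          exact (Fin.cons_inj.mp h).2
        · intro y hy
          obtain ⟨hy, rfl⟩ := mem_filter.mp hy
          exact ⟨Fin.tail y, by simpa [F] using hy, Fin.cons_self_tail y⟩
      rw [hb, hb, ← card_filter_add_card_filter_not (s := S) (fun y => y 0 = true)]
      simp
    have hpos : (0 : ℝ) < S.card := by exact_mod_cast hS.card_pos
    have hsum := labelProb_true_add_false p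
    obtain ⟨b, hb, hb'⟩ : ∃ b, (F b).Nonempty ∧ S.card * labelProb p b ≤ (F b).card := by
      by_contra! hcon
      -- An empty set of continuations contributes nothing, so the comparison holds for both labels.
      have hle : ∀ b, ((F b).card : ℝ) ≤ S.card * labelProb p b := by
        intro b
        rcases (F b).eq_empty_or_nonempty with h | h
        · rw [h, card_empty, Nat.cast_zero]
          refine mul_nonneg hpos.le ?_
          cases b <;> simp [labelProb, p.2.1, p.2.2]
        · exact (hcon b h).le
      rcases (F true).eq_empty_or_nonempty with h | h
      · rcases (F false).eq_empty_or_nonempty with h' | h'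
        · rw [h, h'] at hcard
          simp at hcard
          exact hS.ne_empty hcard
        · have := hcon false h'
          have := hle true
          nlinarith
      · have := hcon true h
        have := hle false
        nlinarith
    refine le_iSup_of_le b ?_
    have hF : (0 : ℝ) < (F b).card := by exact_mod_cast hb.card_pos
    have hstep : ((Real.log S.card : ℝ) : EReal) ≤ logLoss p b + (Real.log (F b).card : ℝ) := by
      rcases lt_or_ge 0 (labelProb p b) with h | h
      · rw [logLoss_eq_coe h, ← EReal.coe_add, EReal.coe_le_coe_iff]
        have := Real.log_le_log (mul_pos hpos h) hb'
        rw [Real.log_mul hpos.ne' h.ne'] at this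
        linarith
      · rw [logLoss_eq_top h, EReal.top_add_coe]
        exact le_top
    refine (add_le_add le_rfl hstep).trans ?_
    rw [← add_assoc]
    refine ih (Fin.tail x) (F b) hb (a + logLoss p b) _ fun ps z hz => ?_
    have := hR (Fin.cons p ps) (Fin.cons b z) (by simpa [F] using hz)
    rw [Fin.sum_univ_succ] at this
    simpa [add_assoc] using this

/-- For label sequences with at most `k` ones, some parameter `w` of the class has loss at most
`(k / 2) * log k` on the first `T` basis vectors. -/
theorem exists_sum_logLoss_le {T d k : ℕ} (hd : T ≤ d) (hk : 1 ≤ k) (x : Fin T → UnitBall d)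
    (hx : ∀ t, (x t : EuclideanSpace ℝ (Fin d)) = EuclideanSpace.single (Fin.castLE hd t) 1)
    (y : Fin T → Bool) (hy : (univ.filter fun t => y t = true).card ≤ k) :
    ∃ w : UnitBall d, ∑ t, logLoss (absInner w (x t)) (y t) ≤
      ((k * (Real.log k / 2) : ℝ) : EReal) := by
  have hk0 : (0 : ℝ) < k := by exact_mod_cast hk
  have hk1 : (1 : ℝ) ≤ k := by exact_mod_cast hk
  set A : Finset (Fin d) := (univ.filter fun t => y t = true).map (Fin.castLEEmb hd) with hA
  have hAc : A.card ≤ k := by rwa [hA, card_map]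
  let v : EuclideanSpace ℝ (Fin d) := WithLp.toLp 2 fun j => if j ∈ A then (√k)⁻¹ else 0
  have hv : v ∈ Metric.closedBall (0 : EuclideanSpace ℝ (Fin d)) 1 := by
    rw [mem_closedBall_zero_iff, EuclideanSpace.norm_eq, Real.sqrt_le_one]
    have : ∀ j, ‖v j‖ ^ 2 = if j ∈ A then (k : ℝ)⁻¹ else 0 := by
      intro j
      by_cases hj : j ∈ A <;> simp [v, hj]
    rw [sum_congr rfl fun j _ => this j, ← sum_filter, sum_const, nsmul_eq_mul,
      ← div_eq_mul_inv, div_le_one hk0]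
    simpa using hAc
  have hval : ∀ t, (absInner ⟨v, hv⟩ (x t) : ℝ) = if y t = true then (√k)⁻¹ else 0 := by
    intro t
    have hmem : Fin.castLE hd t ∈ A ↔ y t = true := by
      simp [hA]
    simp only [absInner, hx, EuclideanSpace.inner_single_right]
    by_cases h : y t = true <;> simp [v, hmem, h]
  refine ⟨⟨v, hv⟩, ?_⟩
  have hl : ∀ t, logLoss (absInner ⟨v, hv⟩ (x t)) (y t) =
      ((if y t = true then Real.log k / 2 else 0 : ℝ) : EReal) := by
    intro t
    have hlp : labelProb (absInner ⟨v, hv⟩ (x t)) (y t) = if y t = true then (√k)⁻¹ else 1 := by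
      rw [hval]
      cases y t <;> simp [labelProb]
    rw [logLoss_eq_coe, hlp]
    · by_cases h : y t = true <;> simp [h, Real.log_inv, Real.log_sqrt]
    · rw [hlp]
      split_ifs <;> positivity
  rw [sum_congr rfl fun t _ => hl t, ← coe_ereal_sum, EReal.coe_le_coe_iff,
    ← sum_filter, sum_const, nsmul_eq_mul]
  have : 0 ≤ Real.log k := Real.log_nonneg hk1
  gcongr

theorem log_card_sub_le_sequentialRegret {T d k : ℕ} (hd : T ≤ d) (hk : 1 ≤ k)
    (S : Finset (Fin T → Bool)) (hS : S.Nonempty)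
    (hones : ∀ y ∈ S, (univ.filter fun t => y t = true).card ≤ k) :
    ((Real.log S.card - k * (Real.log k / 2) : ℝ) : EReal) ≤
      sequentialRegret (parametricClass (absInner (d := d))) T := by
  let x : Fin T → UnitBall d := fun t => ⟨EuclideanSpace.single (Fin.castLE hd t) 1, by simp⟩
  have h := le_gameValue_of_card T x S hS ((-(k * (Real.log k / 2)) : ℝ) : EReal)
    (pointwiseRegret (parametricClass (absInner (d := d)))) fun p y hy => by
      obtain ⟨w, hw⟩ := exists_sum_logLoss_le hd hk x (fun _ => rfl) y (hones y hy)
      rw [pointwiseRegret, add_comm, EReal.coe_neg, ← sub_eq_add_neg]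
      exact EReal.sub_le_sub le_rfl
        ((iInf₂_le (absInner w) ⟨w, rfl⟩).trans hw)
  rwa [← EReal.coe_add, neg_add_eq_sub] at h

theorem card_filter_ones (T k : ℕ) :
    (univ.filter fun y : Fin T → Bool => (univ.filter fun t => y t = true).card = k).card =
      T.choose k := by
  have h : T.choose k = (powersetCard k (univ : Finset (Fin T))).card := by simp
  rw [h]
  refine card_bij' (fun y _ => univ.filter fun t => y t = true) (fun s _ t => decide (t ∈ s))
    ?_ ?_ ?_ ?_ <;> simp +contextual [mem_powersetCard]

/-- For `2 k ≤ T + 1`, there are at least `(T / (2 k)) ^ k` subsets of size `k`. -/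
theorem mul_log_le_log_choose {T k : ℕ} (hk : 1 ≤ k) (hkT : 2 * k ≤ T + 1) :
    k * (Real.log T - Real.log 2 - Real.log k) ≤ Real.log (T.choose k) := by
  have hT : 0 < T := by omega
  have hT0 : (0 : ℝ) < T := by exact_mod_cast hT
  have hk0 : (0 : ℝ) < k := by exact_mod_cast hk
  have h1 : ((T : ℝ) / (2 * k)) ^ k ≤ T.choose k := by
    refine le_trans ?_ (Nat.pow_le_choose k T)
    rw [le_div_iff₀ (by positivity), div_pow, mul_pow]
    have hf : ((k ! : ℕ) : ℝ) ≤ k ^ k := by exact_mod_cast Nat.factorial_le_pow k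
    have hs : (T : ℝ) ≤ 2 * ((T + 1 - k : ℕ) : ℝ) := by
      have : T ≤ 2 * (T + 1 - k) := by omega
      exact_mod_cast this
    calc (T : ℝ) ^ k / (2 ^ k * k ^ k) * (k ! : ℕ)
        ≤ (T : ℝ) ^ k / (2 ^ k * k ^ k) * k ^ k := by gcongr
      _ = (T / 2 : ℝ) ^ k := by rw [div_pow]; field_simp
      _ ≤ _ := by gcongr; linarith
  have h2 := Real.log_le_log (by positivity) h1
  rwa [Real.log_pow, Real.log_div (by positivity) (by positivity),
    Real.log_mul (by norm_num) hk0.ne', ← sub_sub] at h2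

theorem exists_le_sequentialRegret_absInner :
    ∃ c : ℝ, 0 < c ∧ ∀ T d : ℕ, 1 ≤ T → T ≤ d →
      ((c * (T : ℝ) ^ (2 / 3 : ℝ) : ℝ) : EReal) ≤
        sequentialRegret (parametricClass (absInner (d := d))) T := by
  refine ⟨1 / 8, by norm_num, fun T d hT hd => ?_⟩
  have hT1 : (1 : ℝ) ≤ T := by exact_mod_cast hT
  have hT0 : (0 : ℝ) < T := by linarith
  set u : ℝ := (T : ℝ) ^ (1 / 3 : ℝ) with hu
  have hu0 : 0 < u := Real.rpow_pos_of_pos hT0 _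
  have hu1 : 1 ≤ u := Real.one_le_rpow hT1 (by norm_num)
  have hu3 : u ^ 3 = T := by
    rw [hu, ← Real.rpow_natCast, ← Real.rpow_mul hT0.le]
    norm_num
  have hu2 : (T : ℝ) ^ (2 / 3 : ℝ) = u ^ 2 := by
    rw [hu, ← Real.rpow_natCast, ← Real.rpow_mul hT0.le]
    norm_num
  have hlog2 := Real.log_two_gt_d9
  rw [hu2]
  rcases lt_or_ge u 2 with hsmall | hlarge
  · -- For small `T` the uncertainty in the first label alone suffices.
    let S : Finset (Fin T → Bool) := {fun _ => false, fun t => decide (t = ⟨0, hT⟩)}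
    have hne : (fun _ => false : Fin T → Bool) ≠ fun t => decide (t = ⟨0, hT⟩) := fun h => by
      simpa using congrFun h ⟨0, hT⟩
    have hcard : S.card = 2 := card_pair hne
    refine le_trans ?_ (log_card_sub_le_sequentialRegret hd le_rfl S
      (by simp [S]) (by simp [S, filter_eq']))
    rw [EReal.coe_le_coe_iff, hcard]
    simp only [Nat.cast_one, Real.log_one, Nat.cast_ofNat]
    nlinarith
  · set k := ⌊u ^ 2 / 4⌋₊ with hk
    have hkle : (k : ℝ) ≤ u ^ 2 / 4 := Nat.floor_le (by positivity)
    have hk1 : 1 ≤ k := Nat.le_floor (by norm_num; nlinarith)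
    have hklt : u ^ 2 / 4 < k + 1 := Nat.lt_floor_add_one _
    have hk1' : (1 : ℝ) ≤ k := by exact_mod_cast hk1
    have hkT : 2 * k ≤ T + 1 := by
      have : (2 * k : ℝ) ≤ T + 1 := by nlinarith [sq_nonneg u]
      exact_mod_cast this
    have hchoose := mul_log_le_log_choose hk1 hkT
    have hcard := card_filter_ones T k
    refine le_trans ?_ (log_card_sub_le_sequentialRegret hd hk1 _
      (card_pos.mp (hcard ▸ Nat.choose_pos (by omega)))
      (fun y hy => (mem_filter.mp hy).2.le))
    rw [EReal.coe_le_coe_iff, hcard]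
    have hlogT : Real.log T = 3 * Real.log u := by
      rw [← hu3, Real.log_pow]
      norm_num
    -- `k ≤ u ^ 2 / 4` makes `T / (2 * k ^ (3 / 2))` at least `4`.
    have hlogk : Real.log k ≤ 2 * Real.log u - 2 * Real.log 2 := by
      refine (Real.log_le_log (by linarith) hkle).trans_eq ?_
      rw [Real.log_div (by positivity) (by norm_num), Real.log_pow,
        show (4 : ℝ) = 2 ^ 2 by norm_num, Real.log_pow]
      norm_num
    have hfac : 1 ≤ Real.log T - Real.log 2 - Real.log k - Real.log k / 2 := by
      rw [hlogT]
      linarith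
    have := mul_le_mul_of_nonneg_left hfac (show (0 : ℝ) ≤ k by positivity)
    nlinarith

end OnlineLogLoss

theorem mainTheorem8 :
    (∃ c : ℝ, 0 < c ∧ ∀ T d : ℕ, 1 ≤ T → T ≤ d →
      ((c * (T : ℝ) ^ (2 / 3 : ℝ) : ℝ) : EReal) ≤
        OnlineLogLoss.sequentialRegret
          (OnlineLogLoss.parametricClass (OnlineLogLoss.absInner (d := d))) T) ∧
    (∃ (C : ℝ) (k : ℕ), 0 < C ∧ ∀ T d : ℕ, 1 ≤ T →
      OnlineLogLoss.sequentialRegret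
          (OnlineLogLoss.parametricClass (OnlineLogLoss.absInner (d := d))) T ≤
        ((C * (T : ℝ) ^ (2 / 3 : ℝ) * (1 + Real.log T) ^ k : ℝ) : EReal)) :=
  ⟨OnlineLogLoss.exists_le_sequentialRegret_absInner,
    OnlineLogLoss.exists_sequentialRegret_absInner_le⟩
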